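/- Let $N$ and $d$ be nonnegative integers. Call cones $\sigma,\sigma'\subset\mathbb R^d$ equivalent if some linear automorphism of $\mathbb R^d$ that maps $\mathbb Z^d$ onto $\mathbb Z^d$ maps $\sigma$ onto $\sigma'$. For a pointed rational polyhedral cone $\sigma\subset\mathbb R^d$ let $v_1,\dots,v_r$ be its primitive generators, i.e. the primitive lattice vectors on its rays; $\sigma$ is called $\mathbb Q$-Gorenstein if there is a linear functional taking the value $1$ on all $v_i$ (equivalently, for $\sigma\ne\{0\}$, the $v_i$ lie in an affine hyperplane of the linear span of $\sigma$). Let $\operatorname{nib}(\sigma)=\operatorname{conv}(0,v_1,\dots,v_r)$, and let the Hilbert basis $\mathcal H(\sigma)$ be the unique minimal set of generators of the semigroup $\sigma\cap\mathbb Z^d$. Then, up to equivalence, there are only finitely many $\mathbb Q$-Gorenstein cones $\sigma\subset\mathbb R^d$ (of any dimension) with $$\#\mathcal H(\sigma)+\#\bigl(\operatorname{nib}(\sigma)\cap\mathbb Z^d\bigr)\le N+1 .$$ -/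

import Mathlib

namespace LatticeCone

/-- The lattice `ℤ^d` inside `ℝ^d`. -/
def integerLattice (d : ℕ) : AddSubgroup (Fin d → ℝ) :=
  ((Int.castAddHom ℝ).compLeft (Fin d)).range

/-- A lattice vector is primitive if it is nonzero and not a proper multiple of another
lattice vector. -/
def IsPrimitive {d : ℕ} (v : Fin d → ℝ) : Prop :=
  v ∈ integerLattice d ∧ v ≠ 0 ∧
    ∀ w ∈ integerLattice d, ∀ k : ℕ, v = k • w → k = 1

/-- A pointed (strongly convex) rational polyhedral cone in `ℝ^d`, of any dimension: it is
generated by finitely many lattice vectors and contains no line. (Mathlib's `PointedCone` is a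
convex cone which contains `0`; "pointed" in the geometric sense is `Salient`.) -/
def IsPointedRational {d : ℕ} (σ : PointedCone ℝ (Fin d → ℝ)) : Prop :=
  (∃ s : Finset (Fin d → ℝ), (s : Set (Fin d → ℝ)) ⊆ integerLattice d ∧
    PointedCone.hull ℝ (s : Set (Fin d → ℝ)) = σ) ∧
  (σ : ConvexCone ℝ (Fin d → ℝ)).Salient

/-- The primitive generators `v₁, …, v_r` of `σ`: the primitive lattice vectors on the
one-dimensional faces (rays) of `σ`. -/
def primitiveGenerators {d : ℕ} (σ : PointedCone ℝ (Fin d → ℝ)) : Set (Fin d → ℝ) :=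
  {v | IsPrimitive v ∧ (PointedCone.hull ℝ {v}).IsFaceOf σ}

/-- `σ` is a `ℚ`-Gorenstein cone: a pointed rational cone whose primitive generators lie in an
affine hyperplane of its linear span. As they span the latter, the hyperplane does not contain
the origin, and so is the level set at height `1` of a linear functional. -/
def IsQGorenstein {d : ℕ} (σ : PointedCone ℝ (Fin d → ℝ)) : Prop :=
  IsPointedRational σ ∧
    ∃ height : (Fin d → ℝ) →ₗ[ℝ] ℝ, ∀ v ∈ primitiveGenerators σ, height v = 1

/-- The nib of `σ`: the convex hull of the origin and the primitive generators. -/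
def nib {d : ℕ} (σ : PointedCone ℝ (Fin d → ℝ)) : Set (Fin d → ℝ) :=
  convexHull ℝ (insert 0 (primitiveGenerators σ))

/-- The semigroup `σ ∩ ℤ^d` (with zero). -/
def latticeMonoid {d : ℕ} (σ : PointedCone ℝ (Fin d → ℝ)) : AddSubmonoid (Fin d → ℝ) :=
  σ.toAddSubmonoid ⊓ (integerLattice d).toAddSubmonoid

/-- The Hilbert basis of `σ`: the nonzero elements of `σ ∩ ℤ^d` which are not a sum of two
nonzero elements of `σ ∩ ℤ^d`. By `eq_hilbertBasis_of_minimal` it is the only candidate for a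
minimal set of generators of this semigroup. -/
def hilbertBasis {d : ℕ} (σ : PointedCone ℝ (Fin d → ℝ)) : Set (Fin d → ℝ) :=
  {x | x ∈ latticeMonoid σ ∧ x ≠ 0 ∧
    ∀ y ∈ latticeMonoid σ, ∀ z ∈ latticeMonoid σ, x = y + z → y = 0 ∨ z = 0}

/-- Two cones in `ℝ^d` are (integrally) equivalent if a linear automorphism of `ℝ^d` which maps
`ℤ^d` onto itself maps the one onto the other. -/
def IntegrallyEquivalent {d : ℕ} (σ τ : PointedCone ℝ (Fin d → ℝ)) : Prop :=
  ∃ e : (Fin d → ℝ) ≃ₗ[ℝ] (Fin d → ℝ),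
    e '' (integerLattice d : Set (Fin d → ℝ)) = integerLattice d ∧
    e '' (σ : Set (Fin d → ℝ)) = τ

/-- The Hilbert basis is contained in every set of generators of `σ ∩ ℤ^d`. -/
theorem hilbertBasis_subset {d : ℕ} {σ : PointedCone ℝ (Fin d → ℝ)} {G : Set (Fin d → ℝ)}
    (hG : AddSubmonoid.closure G = latticeMonoid σ) : hilbertBasis σ ⊆ G := by
  intro x hx
  have h : ∀ y (_ : y ∈ AddSubmonoid.closure G), y ∈ hilbertBasis σ → y ∈ G := by
    intro y hy
    induction hy using AddSubmonoid.closure_induction with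
    | mem y hy => exact fun _ => hy
    | zero => exact fun h0 => absurd rfl h0.2.1
    | add y z hy hz ihy ihz =>
      intro h
      rcases h.2.2 y (hG ▸ hy) z (hG ▸ hz) rfl with h0 | h0
      · subst h0; rw [zero_add] at h ⊢; exact ihz h
      · subst h0; rw [add_zero] at h ⊢; exact ihy h
  exact h x (hG ▸ hx.1) hx

/-- Any minimal set of generators of `σ ∩ ℤ^d` is the Hilbert basis, if `σ` is pointed. -/
theorem eq_hilbertBasis_of_minimal {d : ℕ} {σ : PointedCone ℝ (Fin d → ℝ)}
    (hσ : (σ : ConvexCone ℝ (Fin d → ℝ)).Salient) {G : Set (Fin d → ℝ)}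
    (hG : Minimal (fun H => AddSubmonoid.closure H = latticeMonoid σ) G) :
    G = hilbertBasis σ := by
  have hcl : AddSubmonoid.closure G = latticeMonoid σ := hG.prop
  refine Set.Subset.antisymm (fun g hg => ?_) (hilbertBasis_subset hcl)
  have hnot : g ∉ AddSubmonoid.closure (G \ {g}) := by
    intro hmem
    have hle : AddSubmonoid.closure (G \ {g}) = latticeMonoid σ := by
      rw [← hcl]
      refine le_antisymm (AddSubmonoid.closure_mono Set.sdiff_subset) ?_
      rw [AddSubmonoid.closure_le]
      intro x hx
      by_cases hxg : x = g
      · subst hxg; exact hmem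
      · exact AddSubmonoid.subset_closure ⟨hx, hxg⟩
    exact (hG.le_of_le hle Set.sdiff_subset hg).2 rfl
  have hsplit : ∀ y (_ : y ∈ AddSubmonoid.closure G),
      y ∈ AddSubmonoid.closure (G \ {g}) ∨ ∃ y' ∈ latticeMonoid σ, y = g + y' := by
    intro y hy
    induction hy using AddSubmonoid.closure_induction with
    | mem y hy =>
      by_cases hyg : y = g
      · exact Or.inr ⟨0, zero_mem _, by simp [hyg]⟩
      · exact Or.inl (AddSubmonoid.subset_closure ⟨hy, hyg⟩)
    | zero => exact Or.inl (zero_mem _)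
    | add y z hy hz ihy ihz =>
      rcases ihy with hy1 | ⟨y', hy', rfl⟩
      · rcases ihz with hz1 | ⟨z', hz', rfl⟩
        · exact Or.inl (add_mem hy1 hz1)
        · exact Or.inr ⟨y + z', add_mem (hcl ▸ hy) hz', by abel⟩
      · exact Or.inr ⟨y' + z, add_mem hy' (hcl ▸ hz), by abel⟩
  have hpointed : ∀ y ∈ latticeMonoid σ, ∀ z ∈ latticeMonoid σ, g = g + y + z → z = 0 := by
    intro y hy z hz h
    by_contra hz0
    refine hσ z hz.1 hz0 ?_
    have : -z = y := by
      have h' : y + z = 0 := by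
        rw [add_assoc] at h
        exact left_eq_add.mp h
      exact (eq_neg_of_add_eq_zero_left h').symm
    rw [this]
    exact hy.1
  refine ⟨hcl ▸ AddSubmonoid.subset_closure hg, ?_, ?_⟩
  · intro h0
    exact hnot (h0 ▸ zero_mem _)
  · intro y hy z hz h
    by_contra hne
    push Not at hne
    rcases hsplit y (hcl ▸ hy) with hy1 | ⟨y', hy', rfl⟩
    · rcases hsplit z (hcl ▸ hz) with hz1 | ⟨z', hz', rfl⟩
      · have hs := add_mem hy1 hz1
        rw [← h] at hs
        exact hnot hs
      · exact hne.1 (hpointed z' hz' y hy (h.trans (add_comm _ _)))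
    · exact hne.2 (hpointed y' hy' z hz h)

end LatticeCone

namespace LatticeCone

open PointedCone

/-! Write n = N + 1 and let h_1, …, h_m be the Hilbert basis, so m ≤ n. The h_j span a saturated
sublattice (`saturated_span`), so the cone is determined up to equivalence by the lattice of integer
relations among them (`integrallyEquivalent_of_relations_eq`). It remains to bound the number of
relation lattices.

The height functional gives two bounds: every h_j has height at most n, and height greater than 1/n
since otherwise 0, h_j, …, n h_j would be n + 1 lattice points of the nib. Choose a basis of maximal
determinant among the h_j; all coordinates c_ji then lie in [-1, 1]. Reducing k h_j modulo the
chosen basis gives a lattice point of the cone of height at most n², hence a sum of Hilbert basis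
elements with coefficients at most n³. By pigeonhole two reductions agree, so the c_ji have bounded
denominator (`coordinates_mem_boundedFractions`). Finitely many coordinate matrices leave finitely
many relation lattices. -/

/-! ### Lattice vectors and generation by primitive generators. -/

theorem mem_hull_range_iff {ι E : Type*} [Fintype ι] [AddCommGroup E] [Module ℝ E]
    {v : ι → E} {x : E} :
    x ∈ hull ℝ (Set.range v) ↔ ∃ t : ι → ℝ, (∀ i, 0 ≤ t i) ∧ ∑ i, t i • v i = x := by
  rw [Submodule.mem_span_range_iff_exists_fun]
  constructor
  · rintro ⟨c, rfl⟩
    exact ⟨fun i => c i, fun i => (c i).2, rfl⟩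
  · rintro ⟨t, ht, rfl⟩
    exact ⟨fun i => ⟨t i, ht i⟩, rfl⟩

/-- The coordinatewise embedding of `ℤ^d` into `ℝ^d`. -/
def intEmb (d : ℕ) : (Fin d → ℤ) →+ (Fin d → ℝ) := (Int.castAddHom ℝ).compLeft (Fin d)

@[simp] theorem intEmb_apply {d : ℕ} (z : Fin d → ℤ) (i : Fin d) : intEmb d z i = z i := rfl

theorem intEmb_injective (d : ℕ) : Function.Injective (intEmb d) := by
  intro x y h
  funext i
  have := congrFun h i
  simpa using this

theorem mem_integerLattice {d : ℕ} {x : Fin d → ℝ} :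
    x ∈ integerLattice d ↔ ∃ z, intEmb d z = x := Iff.rfl

theorem exists_isPrimitive {d : ℕ} {a : Fin d → ℝ} (ha : a ∈ integerLattice d) (ha0 : a ≠ 0) :
    ∃ w, IsPrimitive w ∧ ∃ k : ℕ, 0 < k ∧ a = k • w := by
  obtain ⟨z, rfl⟩ := mem_integerLattice.1 ha
  induction hs : ∑ i, (z i).natAbs using Nat.strong_induction_on generalizing z with
  | _ s ih =>
    by_cases hp : IsPrimitive (intEmb d z)
    · exact ⟨_, hp, 1, one_pos, by simp⟩
    · simp only [IsPrimitive, not_and, not_forall] at hp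
      obtain ⟨w, hw, k, hk, hk1⟩ := hp ha ha0
      obtain ⟨y, rfl⟩ := mem_integerLattice.1 hw
      have hzy : z = k • y := intEmb_injective d (by rw [hk, map_nsmul])
      have hy0 : intEmb d y ≠ 0 := by
        intro h
        rw [hk, h, smul_zero] at ha0
        exact ha0 rfl
      have hk0 : k ≠ 0 := by
        rintro rfl
        rw [hk, zero_smul] at ha0
        exact ha0 rfl
      have hpos : 0 < ∑ i, (y i).natAbs := by
        rw [Nat.pos_iff_ne_zero]
        intro h
        apply hy0
        funext i
        have := (Finset.sum_eq_zero_iff.1 h) i (Finset.mem_univ i)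
        simpa using this
      have hlt : ∑ i, (y i).natAbs < s := by
        have : ∑ i, (z i).natAbs = k * ∑ i, (y i).natAbs := by
          rw [hzy, Finset.mul_sum]
          refine Finset.sum_congr rfl fun i _ => ?_
          simp [Int.natAbs_mul]
        rw [← hs, this]
        have : 2 ≤ k := by omega
        nlinarith
      obtain ⟨w, hw, l, hl, hl'⟩ := ih _ hlt y hw hy0 rfl
      exact ⟨w, hw, k * l, by positivity, by rw [hk, hl', mul_smul]⟩

/-- Let r(αa + x') + (βa + y') = ca. If c > rα + β, solving for a puts it in the hull of t.
Otherwise -x' lies in the cone, so x' = 0 by salience. -/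
theorem hull_singleton_isFaceOf {E : Type*} [AddCommGroup E] [Module ℝ E] {t : Set E} {a : E}
    (hsal : (hull ℝ (insert a t) : ConvexCone ℝ E).Salient) (ha : a ∉ hull ℝ t) :
    (hull ℝ {a}).IsFaceOf (hull ℝ (insert a t)) := by
  have hle : hull ℝ t ≤ hull ℝ (insert a t) := Submodule.span_mono (Set.subset_insert _ _)
  have hat : a ∈ hull ℝ (insert a t) := subset_hull (Set.mem_insert _ _)
  refine ⟨Submodule.span_mono (by simp), ?_⟩
  intro x y r hx hy hr hxy
  obtain ⟨α, x', hx', rfl⟩ := Submodule.mem_span_insert.1 hx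
  obtain ⟨β, y', hy', rfl⟩ := Submodule.mem_span_insert.1 hy
  obtain ⟨c, hc⟩ := Submodule.mem_span_singleton.1 hxy
  change (c : ℝ) • a = r • ((α : ℝ) • a + x') + ((β : ℝ) • a + y') at hc
  have hα : (0 : ℝ) ≤ α := α.2
  have hβ : (0 : ℝ) ≤ β := β.2
  rcases lt_or_ge (r * α + β) (c : ℝ) with hlt | hge
  · exfalso
    apply ha
    have hpos : 0 < (c : ℝ) - (r * α + β) := sub_pos.2 hlt
    have key : a = ((c : ℝ) - (r * α + β))⁻¹ • (r • x' + y') := by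
      rw [eq_inv_smul_iff₀ hpos.ne', sub_smul, hc]
      module
    rw [key]
    exact smul_mem _ (inv_nonneg.2 hpos.le) (add_mem (smul_mem _ hr.le hx') hy')
  · have hx0 : x' = 0 := by
      by_contra hne
      refine hsal x' (hle hx') hne ?_
      have key : -x' = r⁻¹ • ((r * (α : ℝ) + β - c) • a + y') := by
        rw [eq_inv_smul_iff₀ hr.ne', sub_smul, hc]
        module
      rw [key]
      exact smul_mem _ (inv_nonneg.2 hr.le)
        (add_mem (smul_mem _ (sub_nonneg.2 hge) hat) (hle hy'))
    rw [hx0, add_zero]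
    exact Submodule.smul_mem _ _ (subset_hull rfl)

/-- In a minimal finite generating set no element lies in the hull of the others, so each spans a
ray. -/
theorem hull_primitiveGenerators {d : ℕ} {σ : PointedCone ℝ (Fin d → ℝ)}
    (hσ : IsPointedRational σ) : hull ℝ (primitiveGenerators σ) = σ := by
  classical
  apply le_antisymm
  · rw [Submodule.span_le]
    intro v hv
    exact hv.2.le (subset_hull rfl)
  obtain ⟨s, ⟨hsl, hs⟩, hmin⟩ := exists_minimal_of_wellFoundedLT
    (fun s : Finset (Fin d → ℝ) => (s : Set (Fin d → ℝ)) ⊆ integerLattice d ∧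
      hull ℝ (s : Set (Fin d → ℝ)) = σ) hσ.1
  conv_lhs => rw [← hs]
  rw [Submodule.span_le]
  intro a ha
  have has : insert a ((s.erase a : Finset _) : Set (Fin d → ℝ)) = s := by
    rw [← Finset.coe_insert, Finset.insert_erase ha]
  have hnot : a ∉ hull ℝ ((s.erase a : Finset _) : Set (Fin d → ℝ)) := by
    intro hmem
    have hsub : (s.erase a : Set (Fin d → ℝ)) ⊆ s := Finset.coe_subset.2 (Finset.erase_subset _ _)
    have := hmin (y := s.erase a) ⟨hsub.trans hsl, by
      rw [← hs]
      conv_rhs => rw [← has]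
      exact (Submodule.span_insert_eq_span hmem).symm⟩ (Finset.erase_subset _ _)
    exact Finset.notMem_erase a s (this ha)
  have hface : (hull ℝ {a}).IsFaceOf σ := by
    have := hull_singleton_isFaceOf (t := ((s.erase a : Finset _) : Set (Fin d → ℝ))) (a := a)
      (by rw [has, hs]; exact hσ.2) hnot
    rwa [has, hs] at this
  have ha0 : a ≠ 0 := by
    rintro rfl
    exact hnot (zero_mem _)
  obtain ⟨w, hw, k, hk, rfl⟩ := exists_isPrimitive (hsl ha) ha0
  have hkr : (0 : ℝ) < k := by exact_mod_cast hk
  have hmem : w ∈ primitiveGenerators σ := by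
    refine ⟨hw, ?_⟩
    have heq : hull ℝ {k • w} = hull ℝ {w} := by
      apply le_antisymm
      · rw [Submodule.span_le, Set.singleton_subset_iff]
        have hw' : w ∈ hull ℝ {w} := subset_hull (Set.mem_singleton w)
        exact nsmul_mem hw' k
      · rw [Submodule.span_le, Set.singleton_subset_iff]
        refine Submodule.mem_span_singleton.2 ⟨⟨(k : ℝ)⁻¹, inv_nonneg.2 hkr.le⟩, ?_⟩
        change (k : ℝ)⁻¹ • (k • w) = w
        rw [← Nat.cast_smul_eq_nsmul ℝ, inv_smul_smul₀ hkr.ne']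
    rwa [← heq]
  have hw' : w ∈ hull ℝ (primitiveGenerators σ) := subset_hull hmem
  exact nsmul_mem hw' k

/-! ### Heights of lattice points and of Hilbert basis elements. -/

section Height

variable {d : ℕ} {σ : PointedCone ℝ (Fin d → ℝ)} {ht : (Fin d → ℝ) →ₗ[ℝ] ℝ}

theorem primitiveGenerators_subset_latticeMonoid :
    primitiveGenerators σ ⊆ latticeMonoid σ := by
  intro v hv
  have h : v ∈ hull ℝ {v} := subset_hull (Set.mem_singleton v)
  exact ⟨hv.2.le h, hv.1.1⟩

theorem exists_sum_smul_primitiveGenerators [Fintype (primitiveGenerators σ)]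
    (hσ : IsPointedRational σ) (hht : ∀ v ∈ primitiveGenerators σ, ht v = 1)
    {x : Fin d → ℝ} (hx : x ∈ σ) :
    ∃ t : primitiveGenerators σ → ℝ, (∀ v, 0 ≤ t v) ∧ ∑ v, t v • (v : Fin d → ℝ) = x ∧
      ht x = ∑ v, t v := by
  rw [← hull_primitiveGenerators hσ,
    ← Subtype.range_coe (s := primitiveGenerators σ), mem_hull_range_iff] at hx
  obtain ⟨t, ht0, rfl⟩ := hx
  refine ⟨t, ht0, rfl, ?_⟩
  rw [map_sum]
  refine Finset.sum_congr rfl fun v _ => ?_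
  rw [map_smul, hht v v.2, smul_eq_mul, mul_one]

theorem height_nonneg [Finite (primitiveGenerators σ)]
    (hσ : IsPointedRational σ) (hht : ∀ v ∈ primitiveGenerators σ, ht v = 1)
    {x : Fin d → ℝ} (hx : x ∈ σ) : 0 ≤ ht x := by
  have := Fintype.ofFinite (primitiveGenerators σ)
  obtain ⟨t, ht0, -, h⟩ := exists_sum_smul_primitiveGenerators hσ hht hx
  rw [h]
  exact Finset.sum_nonneg fun v _ => ht0 v

theorem height_pos [Finite (primitiveGenerators σ)]
    (hσ : IsPointedRational σ) (hht : ∀ v ∈ primitiveGenerators σ, ht v = 1)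
    {x : Fin d → ℝ} (hx : x ∈ σ) (hx0 : x ≠ 0) : 0 < ht x := by
  have := Fintype.ofFinite (primitiveGenerators σ)
  refine lt_of_le_of_ne (height_nonneg hσ hht hx) fun h0 => hx0 ?_
  obtain ⟨t, ht0, h1, h⟩ := exists_sum_smul_primitiveGenerators hσ hht hx
  rw [h, eq_comm, Finset.sum_eq_zero_iff_of_nonneg fun v _ => ht0 v] at h0
  rw [← h1]
  exact Finset.sum_eq_zero fun v hv => by rw [h0 v hv, zero_smul]

theorem mem_nib [Finite (primitiveGenerators σ)]
    (hσ : IsPointedRational σ) (hht : ∀ v ∈ primitiveGenerators σ, ht v = 1)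
    {x : Fin d → ℝ} (hx : x ∈ σ) (hx1 : ht x ≤ 1) : x ∈ nib σ := by
  have := Fintype.ofFinite (primitiveGenerators σ)
  obtain ⟨t, ht0, h1, h⟩ := exists_sum_smul_primitiveGenerators hσ hht hx
  have hc : Convex ℝ (nib σ) := convex_convexHull ℝ _
  have h0 : (0 : Fin d → ℝ) ∈ nib σ := subset_convexHull ℝ _ (Set.mem_insert _ _)
  -- The missing weight 1 - `ht x` is put on the origin, the vertex indexed by `none`.
  have := hc.sum_mem (t := Finset.univ)
    (w := fun o : Option (primitiveGenerators σ) => o.elim (1 - ht x) t)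
    (z := fun o : Option (primitiveGenerators σ) => o.elim 0 Subtype.val)
    (by rintro (_ | v) _ <;> simp [ht0, hx1]) (by simp [Fintype.sum_option, h])
    (by
      rintro (_ | v) _
      · exact h0
      · exact subset_convexHull ℝ _ (Set.mem_insert_of_mem _ v.2))
  simpa [Fintype.sum_option, h1] using this

theorem finite_latticeMonoid_height_le [Finite (primitiveGenerators σ)]
    (hσ : IsPointedRational σ) (hht : ∀ v ∈ primitiveGenerators σ, ht v = 1) (c : ℝ) :
    {x | x ∈ latticeMonoid σ ∧ ht x ≤ c}.Finite := by
  have := Fintype.ofFinite (primitiveGenerators σ)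
  set C : ℤ := ⌈c * ∑ v : primitiveGenerators σ, ‖(v : Fin d → ℝ)‖⌉ with hC
  refine ((Set.finite_Icc (fun _ : Fin d => -C) (fun _ => C)).image (intEmb d)).subset ?_
  rintro x ⟨⟨hx, hxl⟩, hxc⟩
  obtain ⟨z, rfl⟩ := mem_integerLattice.1 hxl
  obtain ⟨t, ht0, h1, h⟩ := exists_sum_smul_primitiveGenerators hσ hht hx
  have hnorm : ‖intEmb d z‖ ≤ C := by
    refine le_trans ?_ (Int.le_ceil _)
    rw [← h1, Finset.mul_sum]
    refine (norm_sum_le _ _).trans (Finset.sum_le_sum fun v _ => ?_)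
    rw [norm_smul, Real.norm_of_nonneg (ht0 v)]
    refine mul_le_mul_of_nonneg_right ?_ (norm_nonneg _)
    refine le_trans ?_ hxc
    rw [h]
    exact Finset.single_le_sum (fun v _ => ht0 v) (Finset.mem_univ v)
  refine ⟨z, ?_, rfl⟩
  have habs : ∀ i, |z i| ≤ C := by
    intro i
    have := (norm_le_pi_norm (intEmb d z) i).trans hnorm
    rw [intEmb_apply, Real.norm_eq_abs] at this
    exact_mod_cast this
  exact ⟨fun i => (abs_le.1 (habs i)).1, fun i => (abs_le.1 (habs i)).2⟩

/-- A counterexample of least height would split into two nonzero summands of smaller height. -/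
theorem closure_hilbertBasis [Finite (primitiveGenerators σ)]
    (hσ : IsPointedRational σ) (hht : ∀ v ∈ primitiveGenerators σ, ht v = 1) :
    AddSubmonoid.closure (hilbertBasis σ) = latticeMonoid σ := by
  apply le_antisymm
  · rw [AddSubmonoid.closure_le]
    exact fun x hx => hx.1
  intro x hx
  by_contra hxc
  obtain ⟨y, ⟨⟨hy, hyx⟩, hyc⟩, hmin⟩ := Set.exists_min_image
    {y | (y ∈ latticeMonoid σ ∧ ht y ≤ ht x) ∧ y ∉ AddSubmonoid.closure (hilbertBasis σ)} ht
    ((finite_latticeMonoid_height_le hσ hht (ht x)).subset fun y hy => hy.1) ⟨x, ⟨hx, le_rfl⟩, hxc⟩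
  have hyH : y ∉ hilbertBasis σ := fun h => hyc (AddSubmonoid.subset_closure h)
  have hy0 : y ≠ 0 := by
    rintro rfl
    exact hyc (zero_mem _)
  apply hyH
  refine ⟨hy, hy0, ?_⟩
  by_contra! hne
  obtain ⟨u, hu, w, hw, rfl, hu0, hw0⟩ := hne
  have h1 := height_pos hσ hht hu.1 hu0
  have h2 := height_pos hσ hht hw.1 hw0
  rw [map_add] at hyx
  have hu' : u ∈ AddSubmonoid.closure (hilbertBasis σ) := by
    by_contra hc
    have := hmin u ⟨⟨hu, by linarith⟩, hc⟩
    rw [map_add] at this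
    linarith
  have hw' : w ∈ AddSubmonoid.closure (hilbertBasis σ) := by
    by_contra hc
    have := hmin w ⟨⟨hw, by linarith⟩, hc⟩
    rw [map_add] at this
    linarith
  exact hyc (add_mem hu' hw')

/-- If a generator v has coefficient above 1, then x - v is still in the cone, so indecomposability
forces x = v. Otherwise all coefficients are at most 1. -/
theorem height_le_of_mem_hilbertBasis [Fintype (primitiveGenerators σ)]
    (hσ : IsPointedRational σ) (hht : ∀ v ∈ primitiveGenerators σ, ht v = 1)
    {x : Fin d → ℝ} (hx : x ∈ hilbertBasis σ) :
    ht x ≤ Fintype.card (primitiveGenerators σ) := by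
  classical
  obtain ⟨t, ht0, h1, h⟩ := exists_sum_smul_primitiveGenerators hσ hht hx.1.1
  by_cases hlt : ∀ v, t v ≤ 1
  · rw [h]
    refine (Finset.sum_le_sum fun v _ => hlt v).trans ?_
    simp
  · push Not at hlt
    obtain ⟨v, hv⟩ := hlt
    have hvM := primitiveGenerators_subset_latticeMonoid v.2
    have hrest : x - v ∈ latticeMonoid σ := by
      refine ⟨?_, (integerLattice d).sub_mem hx.1.2 hvM.2⟩
      change x - v ∈ σ
      have : x - v = ∑ w, (t w - if w = v then 1 else 0) • (w : Fin d → ℝ) := by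
        simp [sub_smul, Finset.sum_sub_distrib, h1, ite_smul]
      rw [this]
      refine sum_mem fun w _ => PointedCone.smul_mem _ ?_
        (primitiveGenerators_subset_latticeMonoid w.2).1
      split_ifs with hw
      · subst hw; linarith
      · simpa using ht0 w
    rcases hx.2.2 v hvM (x - v) hrest (by abel) with h0 | h0
    · exact absurd h0 v.2.1.2.1
    · rw [sub_eq_zero.1 h0, hht v v.2]
      have : 0 < Fintype.card (primitiveGenerators σ) := Fintype.card_pos_iff.2 ⟨v⟩
      exact_mod_cast this

theorem one_lt_mul_height [Finite (primitiveGenerators σ)]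
    (hσ : IsPointedRational σ) (hht : ∀ v ∈ primitiveGenerators σ, ht v = 1) {n : ℕ}
    (hn : (nib σ ∩ integerLattice d).encard ≤ n)
    {x : Fin d → ℝ} (hx : x ∈ latticeMonoid σ) (hx0 : x ≠ 0) : 1 < n * ht x := by
  by_contra! hle
  have hpos := height_pos hσ hht hx.1 hx0
  have hsub : (fun k : ℕ => k • x) '' (Finset.range (n + 1)) ⊆ nib σ ∩ integerLattice d := by
    rintro _ ⟨k, hk, rfl⟩
    have hk' : (k : ℝ) ≤ n := by
      have : k < n + 1 := by simpa using hk
      exact_mod_cast Nat.lt_succ_iff.1 this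
    have hkx : k • x ∈ latticeMonoid σ := nsmul_mem hx k
    refine ⟨mem_nib hσ hht hkx.1 ?_, hkx.2⟩
    rw [map_nsmul, nsmul_eq_mul]
    nlinarith
  have hinj : Function.Injective (fun k : ℕ => k • x) := by
    intro k l hkl
    have : ht (k • x) = ht (l • x) := congrArg ht hkl
    rw [map_nsmul, map_nsmul, nsmul_eq_mul, nsmul_eq_mul] at this
    exact_mod_cast mul_right_cancel₀ hpos.ne' this
  have := (Set.encard_le_encard hsub).trans hn
  rw [hinj.encard_image, Set.encard_coe_eq_coe_finsetCard, Finset.card_range] at this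
  have h' : n + 1 ≤ n := by exact_mod_cast this
  omega

end Height

/-- Collects all that the rest of the proof uses about the cone; the vectors `h j` enumerate the
Hilbert basis. -/
theorem exists_generators {d n : ℕ} {σ : PointedCone ℝ (Fin d → ℝ)} (hσ : IsQGorenstein σ)
    (hn : (hilbertBasis σ).encard + (nib σ ∩ integerLattice d).encard ≤ n) :
    ∃ m ≤ n, ∃ h : Fin m → Fin d → ℤ, hull ℝ (Set.range fun j => intEmb d (h j)) = σ ∧
      (∀ x, intEmb d x ∈ σ → ∃ a : Fin m → ℕ, x = ∑ j, a j • h j) ∧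
      ∃ ht : (Fin d → ℝ) →ₗ[ℝ] ℝ, ∀ j, 1 < n * ht (intEmb d (h j)) ∧ ht (intEmb d (h j)) ≤ n := by
  obtain ⟨hσ, ht, hht⟩ := hσ
  have hnH : (hilbertBasis σ).encard ≤ n := le_self_add.trans hn
  have hnN : (nib σ ∩ integerLattice d).encard ≤ n := le_add_self.trans hn
  have hVN : primitiveGenerators σ ⊆ nib σ ∩ integerLattice d := fun v hv =>
    ⟨subset_convexHull ℝ _ (Set.mem_insert_of_mem _ hv), hv.1.1⟩
  have hVn : (primitiveGenerators σ).encard ≤ n := (Set.encard_le_encard hVN).trans hnN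
  have hVfin : Finite (primitiveGenerators σ) := Set.finite_of_encard_le_coe hVn
  have := Fintype.ofFinite (primitiveGenerators σ)
  have hVcard : Fintype.card (primitiveGenerators σ) ≤ n := by
    rw [Set.encard_eq_coe_toFinset_card, Set.toFinset_card] at hVn
    exact_mod_cast hVn
  have hHfin : Finite (hilbertBasis σ) := Set.finite_of_encard_le_coe hnH
  have := Fintype.ofFinite (hilbertBasis σ)
  have hHcard : Fintype.card (hilbertBasis σ) ≤ n := by
    rw [Set.encard_eq_coe_toFinset_card, Set.toFinset_card] at hnH
    exact_mod_cast hnH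
  let f := (Fintype.equivFin (hilbertBasis σ)).symm
  have hf : ∀ j, ∃ z, intEmb d z = f j := fun j => mem_integerLattice.1 (f j).2.1.2
  choose h hh using hf
  have hrange : Set.range (fun j => intEmb d (h j)) = hilbertBasis σ := by
    ext x
    simp only [hh, Set.mem_range]
    constructor
    · rintro ⟨j, rfl⟩
      exact (f j).2
    · intro hx
      exact ⟨f.symm ⟨x, hx⟩, by simp⟩
  have hcl := closure_hilbertBasis hσ hht
  refine ⟨_, hHcard, h, ?_, ?_, ht, ?_⟩
  · rw [hrange]
    apply le_antisymm
    · rw [Submodule.span_le]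
      exact fun x hx => hx.1.1
    · conv_lhs => rw [← hull_primitiveGenerators hσ]
      rw [Submodule.span_le]
      intro v hv
      have hv' := primitiveGenerators_subset_latticeMonoid hv
      rw [← hcl] at hv'
      have hle : AddSubmonoid.closure (hilbertBasis σ) ≤
          (hull ℝ (hilbertBasis σ)).toAddSubmonoid := by
        rw [AddSubmonoid.closure_le]
        exact subset_hull
      exact hle hv'
  · intro x hx
    have hxM : intEmb d x ∈ latticeMonoid σ := ⟨hx, ⟨x, rfl⟩⟩
    rw [← hcl, ← hrange, ← Submodule.span_nat_eq_addSubmonoidClosure,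
      Submodule.mem_toAddSubmonoid, Submodule.mem_span_range_iff_exists_fun] at hxM
    obtain ⟨a, ha⟩ := hxM
    refine ⟨a, intEmb_injective d ?_⟩
    rw [← ha, map_sum]
    simp only [map_nsmul]
  · intro j
    have hj : intEmb d (h j) ∈ hilbertBasis σ := hrange ▸ Set.mem_range_self j
    refine ⟨one_lt_mul_height hσ hht hnN hj.1 hj.2.1, ?_⟩
    exact (height_le_of_mem_hilbertBasis hσ hht hj).trans (by exact_mod_cast hVcard)

/-! ### The relations determine the cone. -/

/-- The quotient is finitely generated and torsion-free over ℤ, hence projective, and the projection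
splits. -/
theorem exists_isCompl_of_saturated {d : ℕ} {L : Submodule ℤ (Fin d → ℤ)}
    (hL : ∀ (k : ℤ) (x : Fin d → ℤ), k ≠ 0 → k • x ∈ L → x ∈ L) : ∃ Q, IsCompl L Q := by
  have htf : Module.IsTorsionFree ℤ ((Fin d → ℤ) ⧸ L) := by
    rw [Module.isTorsionFree_iff_smul_eq_zero]
    intro k q hq
    induction q using Submodule.Quotient.induction_on with
    | _ x =>
      rw [← Submodule.Quotient.mk_smul, Submodule.Quotient.mk_eq_zero] at hq
      rw [Submodule.Quotient.mk_eq_zero]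
      by_cases hk : k = 0
      · exact Or.inl hk
      · exact Or.inr (hL k x hk hq)
  obtain ⟨s, hs⟩ := Module.projective_lifting_property L.mkQ LinearMap.id L.mkQ_surjective
  have hs' : ∀ q, L.mkQ (s q) = q := fun q => LinearMap.congr_fun hs q
  refine ⟨LinearMap.range s, ?_, ?_⟩
  · rw [Submodule.disjoint_def]
    rintro _ hx ⟨q, rfl⟩
    have := hs' q
    rw [Submodule.mkQ_apply, (Submodule.Quotient.mk_eq_zero L).2 hx] at this
    rw [← this, map_zero]
  · rw [codisjoint_iff, eq_top_iff]
    intro x _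
    refine Submodule.mem_sup.2 ⟨x - s (L.mkQ x), ?_, s (L.mkQ x), ⟨_, rfl⟩, sub_add_cancel _ _⟩
    rw [← Submodule.Quotient.mk_eq_zero, ← Submodule.mkQ_apply, map_sub, hs', sub_self]

theorem exists_linearEquiv_extending {d : ℕ} {L L' : Submodule ℤ (Fin d → ℤ)}
    (hL : ∀ (k : ℤ) (x : Fin d → ℤ), k ≠ 0 → k • x ∈ L → x ∈ L)
    (hL' : ∀ (k : ℤ) (x : Fin d → ℤ), k ≠ 0 → k • x ∈ L' → x ∈ L') (ψ : L ≃ₗ[ℤ] L') :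
    ∃ φ : (Fin d → ℤ) ≃ₗ[ℤ] (Fin d → ℤ), ∀ x : L, φ x = ψ x := by
  obtain ⟨Q, hQ⟩ := exists_isCompl_of_saturated hL
  obtain ⟨Q', hQ'⟩ := exists_isCompl_of_saturated hL'
  have e := Submodule.prodEquivOfIsCompl L Q hQ
  have e' := Submodule.prodEquivOfIsCompl L' Q' hQ'
  have hrank : Module.finrank ℤ Q = Module.finrank ℤ Q' := by
    have h1 := e.finrank_eq
    have h2 := e'.finrank_eq
    rw [Module.finrank_prod] at h1 h2
    have h3 := ψ.finrank_eq
    omega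
  refine ⟨(Submodule.prodEquivOfIsCompl L Q hQ).symm ≪≫ₗ
    ψ.prodCongr (LinearEquiv.ofFinrankEq Q Q' hrank) ≪≫ₗ
    Submodule.prodEquivOfIsCompl L' Q' hQ', fun x => ?_⟩
  simp

/-- Both spans are ℤ^m modulo the same relations; saturation lets the resulting isomorphism extend
to ℤ^d. -/
theorem exists_linearEquiv_of_relations_eq {d m : ℕ} {h h' : Fin m → Fin d → ℤ}
    (hs : ∀ (k : ℤ) (x : Fin d → ℤ), k ≠ 0 → k • x ∈ Submodule.span ℤ (Set.range h) →
      x ∈ Submodule.span ℤ (Set.range h))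
    (hs' : ∀ (k : ℤ) (x : Fin d → ℤ), k ≠ 0 → k • x ∈ Submodule.span ℤ (Set.range h') →
      x ∈ Submodule.span ℤ (Set.range h'))
    (hrel : {a : Fin m → ℤ | ∑ j, a j • h j = 0} = {a | ∑ j, a j • h' j = 0}) :
    ∃ φ : (Fin d → ℤ) ≃ₗ[ℤ] (Fin d → ℤ), ∀ j, φ (h j) = h' j := by
  have hker : LinearMap.ker (Fintype.linearCombination ℤ h) =
      LinearMap.ker (Fintype.linearCombination ℤ h') := by
    ext a
    simpa [Fintype.linearCombination_apply] using Set.ext_iff.1 hrel a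
  have hr := Fintype.range_linearCombination ℤ h
  have hr' := Fintype.range_linearCombination ℤ h'
  rw [← hr] at hs
  rw [← hr'] at hs'
  obtain ⟨φ, hφ⟩ := exists_linearEquiv_extending hs hs'
    ((Fintype.linearCombination ℤ h).quotKerEquivRange.symm ≪≫ₗ
      Submodule.quotEquivOfEq _ _ hker ≪≫ₗ (Fintype.linearCombination ℤ h').quotKerEquivRange)
  refine ⟨φ, fun j => ?_⟩
  have h1 : Fintype.linearCombination ℤ h (Pi.single j 1) = h j := by
    simp
  have h2 : Fintype.linearCombination ℤ h' (Pi.single j 1) = h' j := by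
    simp
  have := hφ ((Fintype.linearCombination ℤ h).quotKerEquivRange
    (Submodule.Quotient.mk (Pi.single j 1)))
  rwa [LinearMap.quotKerEquivRange_apply_mk, h1, LinearEquiv.trans_apply, LinearEquiv.trans_apply,
    LinearEquiv.symm_apply_apply, Submodule.quotEquivOfEq_mk, LinearMap.quotKerEquivRange_apply_mk,
    h2] at this

/-- The real linear extension of an automorphism of `ℤ^d`. -/
theorem exists_real_extension {d : ℕ} (φ : (Fin d → ℤ) ≃ₗ[ℤ] (Fin d → ℤ)) :
    ∃ e : (Fin d → ℝ) ≃ₗ[ℝ] (Fin d → ℝ), ∀ z, e (intEmb d z) = intEmb d (φ z) := by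
  set A := LinearMap.toMatrix' (φ : (Fin d → ℤ) →ₗ[ℤ] (Fin d → ℤ)) with hA
  set B := LinearMap.toMatrix' (φ.symm : (Fin d → ℤ) →ₗ[ℤ] (Fin d → ℤ)) with hB
  have hAB : A * B = 1 := by
    rw [hA, hB, ← LinearMap.toMatrix'_comp, LinearEquiv.comp_symm, LinearMap.toMatrix'_id]
  have hBA : B * A = 1 := by
    rw [hA, hB, ← LinearMap.toMatrix'_comp, LinearEquiv.symm_comp, LinearMap.toMatrix'_id]
  let f := Int.castRingHom ℝ
  have hAB' : A.map f * B.map f = 1 := by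
    rw [← Matrix.map_mul, hAB, Matrix.map_one _ (map_zero f) (map_one f)]
  have hBA' : B.map f * A.map f = 1 := by
    rw [← Matrix.map_mul, hBA, Matrix.map_one _ (map_zero f) (map_one f)]
  refine ⟨Matrix.toLin'OfInv hBA' hAB', fun z => ?_⟩
  have hφ : φ z = A.mulVec z := by
    rw [hA, LinearMap.toMatrix'_mulVec]
    rfl
  funext i
  rw [hφ]
  rw [Matrix.toLin'OfInv_apply, Matrix.toLin'_apply, intEmb_apply]
  exact (RingHom.map_mulVec f A z i).symm

/-- If kx = ∑ c_j h_j, adding ∑ |c_j| h_j moves x into the cone: the coefficients c_j/k + |c_j| are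
nonnegative because |k| ≥ 1. There `hnorm` applies. -/
theorem saturated_span {d m : ℕ} {h : Fin m → Fin d → ℤ}
    (hnorm : ∀ x, intEmb d x ∈ hull ℝ (Set.range fun j => intEmb d (h j)) →
      ∃ a : Fin m → ℕ, x = ∑ j, a j • h j) (k : ℤ) (x : Fin d → ℤ) (hk : k ≠ 0)
    (hx : k • x ∈ Submodule.span ℤ (Set.range h)) : x ∈ Submodule.span ℤ (Set.range h) := by
  obtain ⟨c, hc⟩ := (Submodule.mem_span_range_iff_exists_fun ℤ).1 hx
  have hsum : ∑ j, |c j| • h j ∈ Submodule.span ℤ (Set.range h) :=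
    sum_mem fun j _ => Submodule.smul_mem _ _ (Submodule.subset_span ⟨j, rfl⟩)
  have hkr : (k : ℝ) ≠ 0 := by exact_mod_cast hk
  have hmem : intEmb d (x + ∑ j, |c j| • h j) ∈
      hull ℝ (Set.range fun j => intEmb d (h j)) := by
    rw [mem_hull_range_iff]
    refine ⟨fun j => (k : ℝ)⁻¹ * c j + |c j|, fun j => ?_, ?_⟩
    · have h1 : |(k : ℝ)⁻¹ * c j| ≤ |(c j : ℝ)| := by
        rw [abs_mul]
        refine mul_le_of_le_one_left (abs_nonneg _) ?_
        rw [abs_inv]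
        refine inv_le_one_of_one_le₀ ?_
        exact_mod_cast Int.one_le_abs hk
      have h2 := neg_abs_le ((k : ℝ)⁻¹ * c j)
      change 0 ≤ (k : ℝ)⁻¹ * c j + ((|c j| : ℤ) : ℝ)
      rw [Int.cast_abs]
      linarith
    · have hkx : intEmb d x = (k : ℝ)⁻¹ • ∑ j, (c j : ℝ) • intEmb d (h j) := by
        rw [eq_inv_smul_iff₀ hkr]
        have := congrArg (intEmb d) hc
        simpa only [map_sum, map_zsmul, ← Int.cast_smul_eq_zsmul ℝ] using this.symm
      rw [map_add, hkx, map_sum, Finset.smul_sum, ← Finset.sum_add_distrib]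
      refine Finset.sum_congr rfl fun j _ => ?_
      rw [add_smul, mul_smul, map_zsmul, ← Int.cast_smul_eq_zsmul ℝ, Int.cast_abs]
  obtain ⟨a, ha⟩ := hnorm _ hmem
  rw [eq_sub_of_add_eq ha]
  exact sub_mem (sum_mem fun j _ => nsmul_mem (Submodule.subset_span (Set.mem_range_self j)) _) hsum

theorem integrallyEquivalent_of_relations_eq {d m : ℕ} {h h' : Fin m → Fin d → ℤ}
    (hnorm : ∀ x, intEmb d x ∈ hull ℝ (Set.range fun j => intEmb d (h j)) →
      ∃ a : Fin m → ℕ, x = ∑ j, a j • h j)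
    (hnorm' : ∀ x, intEmb d x ∈ hull ℝ (Set.range fun j => intEmb d (h' j)) →
      ∃ a : Fin m → ℕ, x = ∑ j, a j • h' j)
    (hrel : {a : Fin m → ℤ | ∑ j, a j • h j = 0} = {a | ∑ j, a j • h' j = 0}) :
    IntegrallyEquivalent (hull ℝ (Set.range fun j => intEmb d (h j)))
      (hull ℝ (Set.range fun j => intEmb d (h' j))) := by
  obtain ⟨φ, hφ⟩ := exists_linearEquiv_of_relations_eq (saturated_span hnorm)
    (saturated_span hnorm') hrel
  obtain ⟨e, he⟩ := exists_real_extension φ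
  refine ⟨e, ?_, ?_⟩
  · ext x
    constructor
    · rintro ⟨_, ⟨z, rfl⟩, rfl⟩
      exact ⟨φ z, (he z).symm⟩
    · rintro ⟨z, rfl⟩
      refine ⟨intEmb d (φ.symm z), ⟨_, rfl⟩, ?_⟩
      rw [he, φ.apply_symm_apply]
      rfl
  · ext x
    simp only [Set.mem_image, SetLike.mem_coe, mem_hull_range_iff]
    constructor
    · rintro ⟨_, ⟨t, ht, rfl⟩, rfl⟩
      exact ⟨t, ht, by simp [he, hφ]⟩
    · rintro ⟨t, ht, rfl⟩
      exact ⟨_, ⟨t, ht, rfl⟩, by simp [he, hφ]⟩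

/-! ### Coordinates in a basis of maximal determinant. -/

/-- Among the elements of a finite family there is a basis with respect to which all the
coordinates of the family are at most `1` in absolute value. -/
theorem exists_basis_abs_repr_le_one {ι κ W : Type*} [Fintype ι] [DecidableEq ι] [Finite κ]
    [AddCommGroup W] [Module ℝ W] (w : κ → W) (b₀ : Module.Basis ι ℝ W)
    (hb₀ : ∀ i, ∃ j, b₀ i = w j) :
    ∃ b : Module.Basis ι ℝ W, (∀ i, ∃ j, b i = w j) ∧ ∀ j i, |b.repr (w j) i| ≤ 1 := by
  choose f₀ hf₀ using hb₀
  have : Nonempty (ι → κ) := ⟨f₀⟩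
  obtain ⟨g, hg⟩ := Finite.exists_max fun g : ι → κ => |b₀.det (w ∘ g)|
  have h1 : b₀.det (w ∘ f₀) = 1 := by
    have : w ∘ f₀ = b₀ := funext fun i => (hf₀ i).symm
    rw [this, b₀.det_self]
  have hpos : 0 < |b₀.det (w ∘ g)| := by
    have := hg f₀
    rw [h1, abs_one] at this
    linarith
  obtain ⟨hli, hsp⟩ := (Module.Basis.is_basis_iff_det b₀ (v := w ∘ g)).2
    (isUnit_iff_ne_zero.2 (abs_pos.1 hpos))
  refine ⟨Module.Basis.mk hli hsp.ge, fun i => ⟨g i, by simp⟩, fun j i => ?_⟩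
  -- Cramer's rule: replacing the i-th basis vector by `w j` multiplies the determinant by the i-th
  -- coordinate of `w j`, which maximality bounds by 1.
  have key := LinearMap.congr_fun (b₀.det_smul_mk_coord_eq_det_update hli hsp.ge i) (w j)
  have hup : Function.update (w ∘ g) i (w j) = w ∘ Function.update g i j :=
    (Function.comp_update w g i j).symm
  simp only [LinearMap.smul_apply, smul_eq_mul, MultilinearMap.toLinearMap_apply, hup,
    Module.Basis.coord_apply] at key
  have h2 := hg (Function.update g i j)
  have h3 : |b₀.det (w ∘ g)| * |(Module.Basis.mk hli hsp.ge).repr (w j) i| ≤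
      |b₀.det (w ∘ g)| := by
    rw [← abs_mul, key]
    exact h2
  exact le_of_mul_le_mul_left (by simpa using h3) hpos

theorem exists_coordinates {m : ℕ} {E : Type*} [AddCommGroup E] [Module ℝ E] (u : Fin m → E) :
    ∃ e ≤ m, ∃ (g : Fin e → Fin m) (c : Fin m → Fin e → ℝ), LinearIndependent ℝ (u ∘ g) ∧
      (∀ j, u j = ∑ i, c j i • u (g i)) ∧ ∀ j i, |c j i| ≤ 1 := by
  have := FiniteDimensional.span_of_finite ℝ (Set.finite_range u)
  obtain ⟨f, hf, hsp, hli⟩ := Submodule.exists_fun_fin_finrank_span_eq ℝ (Set.range u)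
  set W := Submodule.span ℝ (Set.range u) with hW
  let w : Fin m → W := fun j => ⟨u j, Submodule.subset_span ⟨j, rfl⟩⟩
  let b₀ : Module.Basis (Fin (Module.finrank ℝ W)) ℝ W :=
    (Module.Basis.span hli).map (LinearEquiv.ofEq _ _ hsp)
  obtain ⟨b, hb, hb1⟩ := exists_basis_abs_repr_le_one w b₀ fun i => by
    obtain ⟨j, hj⟩ := hf i
    refine ⟨j, Subtype.ext ?_⟩
    simp [b₀, w, hj, Module.Basis.span_apply]
  choose g hg using hb
  have hgu : u ∘ g = W.subtype ∘ b := by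
    funext i
    simp [hg, w]
  refine ⟨_, ?_, g, fun j i => b.repr (w j) i, ?_, ?_, hb1⟩
  · exact (finrank_range_le_card u).trans_eq (Fintype.card_fin m)
  · rw [hgu]
    exact b.linearIndependent.map' _ W.ker_subtype
  · intro j
    have := congrArg W.subtype (b.sum_repr (w j))
    rw [map_sum] at this
    simp only [map_smul, hg] at this
    exact this.symm

/-! ### Bounded denominators and finiteness of the relations. -/

/-- The fractions with bounded numerator and denominator. -/
def boundedFractions (B : ℕ) : Set ℝ :=
  Set.image2 (fun p q : ℤ => (p : ℝ) / q) (Set.Icc (-B) B) (Set.Icc 0 B)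

theorem finite_boundedFractions (B : ℕ) : (boundedFractions B).Finite :=
  (Set.finite_Icc _ _).image2 _ (Set.finite_Icc _ _)

/-- Equal fractional parts make (l - k)x an integer, of size at most B as |x| ≤ 1. -/
theorem mem_boundedFractions {B k l : ℕ} (hkl : k < l) (hl : l ≤ B) {x : ℝ} (hx : |x| ≤ 1)
    (h : Int.fract (k * x) = Int.fract (l * x)) : x ∈ boundedFractions B := by
  obtain ⟨p, hp⟩ := Int.fract_eq_fract.1 h.symm
  have hq : (0 : ℝ) < (l : ℝ) - k := sub_pos.2 (by exact_mod_cast hkl)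
  have hqB : (l : ℝ) - k ≤ B := by
    have h1 : (l : ℝ) ≤ B := by exact_mod_cast hl
    have h2 : (0 : ℝ) ≤ k := k.cast_nonneg
    linarith
  have hpx : (p : ℝ) = ((l : ℝ) - k) * x := by rw [← hp]; ring
  have hpB : |(p : ℝ)| ≤ B := by
    rw [hpx, abs_mul, abs_of_pos hq]
    nlinarith [abs_nonneg x]
  have hpB' : |p| ≤ (B : ℤ) := by exact_mod_cast hpB
  refine ⟨p, ⟨(abs_le.1 hpB').1, (abs_le.1 hpB').2⟩, (l : ℤ) - k, ⟨by omega, by omega⟩, ?_⟩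
  push_cast
  rw [hpx]
  field_simp

theorem coordinates_mem_boundedFractions {d m e n : ℕ} (hm : m ≤ n) (he : e ≤ m)
    {h : Fin m → Fin d → ℤ}
    (hnorm : ∀ x, intEmb d x ∈ hull ℝ (Set.range fun j => intEmb d (h j)) →
      ∃ a : Fin m → ℕ, x = ∑ j, a j • h j)
    {ht : (Fin d → ℝ) →ₗ[ℝ] ℝ}
    (hht : ∀ j, 1 < n * ht (intEmb d (h j)) ∧ ht (intEmb d (h j)) ≤ n)
    {g : Fin e → Fin m} {c : Fin m → Fin e → ℝ}
    (hli : LinearIndependent ℝ ((fun j => intEmb d (h j)) ∘ g))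
    (hc : ∀ j, intEmb d (h j) = ∑ i, c j i • intEmb d (h (g i))) (hc1 : ∀ j i, |c j i| ≤ 1)
    (j : Fin m) (i : Fin e) : c j i ∈ boundedFractions ((n ^ 3 + 1) ^ n) := by
  have hn0 : (0 : ℝ) ≤ n := n.cast_nonneg
  have hpos : ∀ j, 0 < ht (intEmb d (h j)) := by
    intro j
    have := (hht j).1
    by_contra! hle
    nlinarith
  -- The reduction of k h_j into the half-open parallelepiped spanned by the chosen basis.
  let r : ℕ → Fin d → ℤ := fun k => k • h j - ∑ i, ⌊k * c j i⌋ • h (g i)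
  have hr : ∀ k, intEmb d (r k) = ∑ i, Int.fract (k * c j i) • intEmb d (h (g i)) := by
    intro k
    simp only [r, map_sub, map_nsmul, map_sum, map_zsmul, ← Int.cast_smul_eq_zsmul ℝ,
      ← Nat.cast_smul_eq_nsmul ℝ, Int.fract, sub_smul, Finset.sum_sub_distrib]
    rw [hc j, Finset.smul_sum]
    simp only [smul_smul]
  have hrep : ∀ k, ∃ a : Fin m → Fin (n ^ 3 + 1), r k = ∑ l, (a l : ℕ) • h l := by
    intro k
    obtain ⟨a, ha⟩ := hnorm (r k) (by
      rw [hr]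
      exact sum_mem fun i _ => PointedCone.smul_mem _ (Int.fract_nonneg _)
        (subset_hull ⟨g i, rfl⟩))
    have hle : ht (intEmb d (r k)) ≤ n * n := by
      rw [hr, map_sum]
      have hen : (e : ℝ) ≤ n := by exact_mod_cast he.trans hm
      calc ∑ i, ht (Int.fract (k * c j i) • intEmb d (h (g i))) ≤ ∑ _i : Fin e, (n : ℝ) := by
            refine Finset.sum_le_sum fun i _ => ?_
            rw [map_smul, smul_eq_mul]
            have h1 := (hht (g i)).2
            have h2 := hpos (g i)
            have h3 := (Int.fract_lt_one (k * c j i)).le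
            nlinarith
        _ = e * n := by simp
        _ ≤ n * n := by gcongr
    -- The total height is at most n² and each summand has height above 1/n.
    have hbound : ∀ l, a l < n ^ 3 + 1 := by
      intro l
      have h1 : a l * ht (intEmb d (h l)) ≤ n * n := by
        refine le_trans ?_ hle
        rw [ha, map_sum, map_sum]
        simp only [← Nat.cast_smul_eq_nsmul ℝ, map_smul, map_nsmul, smul_eq_mul]
        exact Finset.single_le_sum (f := fun l => (a l : ℝ) * ht (intEmb d (h l)))
          (fun l _ => mul_nonneg (a l).cast_nonneg (hpos l).le) (Finset.mem_univ l)
      have h2 := (hht l).1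
      have h3 : (a l : ℝ) ≤ n ^ 3 := by
        have h4 : (0 : ℝ) ≤ a l := (a l).cast_nonneg
        nlinarith
      have h5 : a l ≤ n ^ 3 := by exact_mod_cast h3
      omega
    exact ⟨fun l => ⟨a l, hbound l⟩, ha⟩
  choose a ha using hrep
  set B := (n ^ 3 + 1) ^ n with hB
  -- There are B + 1 multipliers 0, …, B but at most B coefficient vectors.
  have hcard : Fintype.card (Fin m → Fin (n ^ 3 + 1)) < Fintype.card (Fin (B + 1)) := by
    simp only [Fintype.card_fun, Fintype.card_fin]
    exact Nat.lt_succ_of_le (Nat.pow_le_pow_right (Nat.succ_pos _) hm)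
  obtain ⟨k, l, hkl, hakl⟩ := Fintype.exists_ne_map_eq_of_card_lt
    (fun k : Fin (B + 1) => a k) hcard
  have hfract : Int.fract ((k : ℕ) * c j i) = Int.fract ((l : ℕ) * c j i) := by
    have hrkl : r k = r l := by
      rw [ha, ha]
      rw [hakl]
    have h1 := congrArg (intEmb d) hrkl
    rw [hr, hr, ← sub_eq_zero, ← Finset.sum_sub_distrib] at h1
    simp only [← sub_smul] at h1
    exact sub_eq_zero.1 (Fintype.linearIndependent_iff.1 hli _ h1 i)
  rcases lt_or_gt_of_ne (Fin.val_ne_of_ne hkl) with hlt | hlt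
  · exact mem_boundedFractions hlt (Nat.lt_succ_iff.1 l.2) (hc1 j i) hfract
  · exact mem_boundedFractions hlt (Nat.lt_succ_iff.1 k.2) (hc1 j i) hfract.symm

/-- For a bounded number of generators of bounded height there are only finitely many
possibilities for the set of their linear relations. -/
theorem exists_finite_relations (n m d : ℕ) (hm : m ≤ n) :
    ∃ T : Set (Set (Fin m → ℤ)), T.Finite ∧ ∀ h : Fin m → Fin d → ℤ,
      (∀ x, intEmb d x ∈ hull ℝ (Set.range fun j => intEmb d (h j)) →
        ∃ a : Fin m → ℕ, x = ∑ j, a j • h j) →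
      (∃ ht : (Fin d → ℝ) →ₗ[ℝ] ℝ,
        ∀ j, 1 < n * ht (intEmb d (h j)) ∧ ht (intEmb d (h j)) ≤ n) →
      {a : Fin m → ℤ | ∑ j, a j • h j = 0} ∈ T := by
  let S := boundedFractions ((n ^ 3 + 1) ^ n)
  -- The relations depend only on the coordinate matrix, and its entries come from a finite set.
  let rel : ∀ e, (Fin m → Fin e → ℝ) → Set (Fin m → ℤ) :=
    fun e c => {a | ∀ i, ∑ j, (a j : ℝ) * c j i = 0}
  refine ⟨⋃ e ∈ Set.Iic m, rel e '' Set.univ.pi fun _ => Set.univ.pi fun _ => S, ?_, ?_⟩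
  · exact (Set.finite_Iic m).biUnion fun e _ =>
      (Set.Finite.pi fun _ => Set.Finite.pi fun _ => finite_boundedFractions _).image _
  rintro h hnorm ⟨ht, hht⟩
  obtain ⟨e, he, g, c, hli, hc, hc1⟩ := exists_coordinates fun j => intEmb d (h j)
  refine Set.mem_biUnion (show e ∈ Set.Iic m from he) ⟨c, ?_, ?_⟩
  · exact fun j _ i _ => coordinates_mem_boundedFractions hm he hnorm hht hli hc hc1 j i
  · ext a
    have hsum : intEmb d (∑ j, a j • h j) =
        ∑ i, (∑ j, (a j : ℝ) * c j i) • intEmb d (h (g i)) := by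
      simp only [map_sum, map_zsmul, ← Int.cast_smul_eq_zsmul ℝ, Finset.sum_smul]
      rw [Finset.sum_comm]
      refine Finset.sum_congr rfl fun j _ => ?_
      rw [hc j, Finset.smul_sum]
      simp only [smul_smul]
    have hzero : ∑ j, a j • h j = 0 ↔ intEmb d (∑ j, a j • h j) = 0 :=
      (map_eq_zero_iff _ (intEmb_injective d)).symm
    simp only [rel, Set.mem_ofPred_eq]
    rw [hzero, hsum]
    constructor
    · intro h0
      exact Finset.sum_eq_zero fun i _ => by rw [h0 i, zero_smul]
    · exact fun h0 => Fintype.linearIndependent_iff.1 hli _ h0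

end LatticeCone

/-! ### Choice of representatives. -/

theorem mainTheorem7 (N d : ℕ) :
    ∃ F : Set (PointedCone ℝ (Fin d → ℝ)), F.Finite ∧
      ∀ σ : PointedCone ℝ (Fin d → ℝ), LatticeCone.IsQGorenstein σ →
        (LatticeCone.hilbertBasis σ).encard +
            (LatticeCone.nib σ ∩ (LatticeCone.integerLattice d : Set (Fin d → ℝ))).encard
          ≤ (N : ℕ∞) + 1 →
        ∃ τ ∈ F, LatticeCone.IntegrallyEquivalent σ τ := by
  classical
  open LatticeCone PointedCone in
  choose T hT hrel using fun m : Fin (N + 2) =>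
    exists_finite_relations (N + 1) m d (Nat.lt_succ_iff.1 m.2)
  let P : (Σ m : Fin (N + 2), Set (Fin m → ℤ)) → PointedCone ℝ (Fin d → ℝ) → Prop :=
    fun K σ => ∃ h : Fin K.1 → Fin d → ℤ,
      (∀ x, intEmb d x ∈ hull ℝ (Set.range fun j => intEmb d (h j)) →
        ∃ a : Fin K.1 → ℕ, x = ∑ j, a j • h j) ∧
      hull ℝ (Set.range fun j => intEmb d (h j)) = σ ∧
      {a : Fin K.1 → ℤ | ∑ j, a j • h j = 0} = K.2
  -- One cone per realised pair of m and relation set; the value `⊥` at unrealised pairs only adds a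
  -- harmless element to the finite set.
  let rep : (Σ m : Fin (N + 2), Set (Fin m → ℤ)) → PointedCone ℝ (Fin d → ℝ) :=
    fun K => if hK : ∃ σ, P K σ then hK.choose else ⊥
  refine ⟨⋃ m, (fun K => rep ⟨m, K⟩) '' T m, Set.finite_iUnion fun m => (hT m).image _, ?_⟩
  intro σ hσ hN
  obtain ⟨m, hm, h, hh, hnorm, hht⟩ := exists_generators (n := N + 1) hσ (by exact_mod_cast hN)
  rw [← hh] at hnorm
  let M : Fin (N + 2) := ⟨m, Nat.lt_succ_iff.2 hm⟩
  let K : Σ m : Fin (N + 2), Set (Fin m → ℤ) := ⟨M, {a | ∑ j, a j • h j = 0}⟩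
  have hK : ∃ σ, P K σ := ⟨σ, h, hnorm, hh, rfl⟩
  refine ⟨rep K, Set.mem_iUnion.2 ⟨M, _, hrel M h hnorm hht, rfl⟩, ?_⟩
  obtain ⟨h', hnorm', hh', hrel'⟩ := hK.choose_spec
  have hrep : rep K = hK.choose := dif_pos hK
  rw [hrep, ← hh', ← hh]
  exact integrallyEquivalent_of_relations_eq hnorm hnorm' hrel'.symm
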